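/- Let points of the unit circle $\mathbb{S}^1$ be represented by their angles (real numbers modulo $2\pi$), and equip it with the metric $d(x,y)=\sqrt{1-\cos(x-y)}$. For a probability distribution $P$ on $\mathbb{S}^1$ that is not a point mass, let $$O(P)=\frac{E\{d(X_1,X_2)^2\,d(X_1,X_3)^2\}}{E\{d(X_1,X_2)^4\}},\qquad X_1,X_2,X_3\sim P\ \text{independent}.$$ Let $X_1,X_2,\ldots$ be independent random points with the uniform distribution $P_0$ on $\mathbb{S}^1$, and let $P_{0,n}$ be the empirical distribution of $X_1,\ldots,X_n$, so that $$O(P_{0,n})=\frac{n^{-3}\sum_{i,j,k=1}^n d(X_i,X_j)^2d(X_i,X_k)^2}{n^{-2}\sum_{i,j=1}^n d(X_i,X_j)^4}$$ (with any fixed value, say $0$, where the denominator vanishes, an event of probability zero for $n\ge 2$). Then, as $n\to\infty$, $$n\left\{\frac23-O(P_{0,n})\right\}\rightsquigarrow \frac{2}{18}\,U+\frac1{18}\,V,$$ where $\rightsquigarrow$ denotes convergence in distribution and $U$, $V$ are independent, each with the $\chi^2$-distribution with $2$ degrees of freedom. -/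

import Mathlib

open MeasureTheory ProbabilityTheory Filter
open scoped Real ENNReal

/-- The object shape `O(P) = E{d(X₁,X₂)² d(X₁,X₃)²} / E{d(X₁,X₂)⁴}` of a distribution `P` on a space
with distance function `d`, where `X₁, X₂, X₃` are independent draws from `P`. -/
noncomputable def objectShape {S : Type*} [MeasurableSpace S] (d : S → S → ℝ) (P : Measure S) : ℝ :=
  (∫ x : S × S × S, d x.1 x.2.1 ^ 2 * d x.1 x.2.2 ^ 2 ∂(P.prod (P.prod P))) /
    (∫ x : S × S, d x.1 x.2 ^ 4 ∂(P.prod P))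

/-- The empirical distribution `(1/n) ∑ᵢ δ_{xᵢ}` of a sample `x₁, …, xₙ`. -/
noncomputable def empiricalMeasure {S : Type*} [MeasurableSpace S] {n : ℕ} (x : Fin n → S) :
    Measure S :=
  (n : ℝ≥0∞)⁻¹ • ∑ i, Measure.dirac (x i)

/-- The distance `d(x, y) = √(1 - cos(x - y))` on the unit circle; its points are given by their
angles, that is, by real numbers modulo `2π`. -/
noncomputable def circleDist (x y : AddCircle (2 * π)) : ℝ :=
  √(1 - Real.Angle.cos (x - y))

/-- The uniform distribution on the unit circle: the law of a point whose angle is uniformly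
distributed on `[0, 2π)`. -/
noncomputable def circleUniform : Measure (AddCircle (2 * π)) :=
  (volume[|Set.Ico 0 (2 * π)]).map fun t : ℝ => (t : AddCircle (2 * π))

/-- The chi-square distribution with `k` degrees of freedom: the law of `Z₁² + ⋯ + Z_k²` for
independent standard normal `Z₁, …, Z_k`. -/
noncomputable def chiSquare (k : ℕ) : Measure ℝ :=
  (Measure.pi fun _ : Fin k => gaussianReal 0 1).map fun z => ∑ i, z i ^ 2

open scoped Topology RealInnerProductSpace

/-! Since `d² = 1 - cos(x - y)`, numerator and denominator of the empirical object shape are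
polynomials `shapeNum m`, `shapeDen m` in the mean `m` of the first two harmonics, `√2 (cos, sin)`
and `√2 (cos 2x, sin 2x)` (`objectShape_empiricalMeasure`). Under the uniform law these four
functions are centred and orthonormal, so `√n m` tends to a standard Gaussian `W`, while `m → 0`
almost surely. In `2/3 - shapeNum/shapeDen = (2 shapeDen - 3 shapeNum)/(3 shapeDen)` the constants
cancel and no linear term occurs: what is left is `|m₁|²/4 + |m₂|²/2` plus a cubic term, `m₁`, `m₂`
being the two harmonic blocks. Multiplied by `n`, the quadratic part becomes one in `√n m`; the
cubic part keeps a factor `m` and vanishes by Slutsky. As `shapeDen m → 3/2`, the limit is `(|W₁|²/4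
+ |W₂|²/2)/(9/2)`, so `U` comes from the second harmonic and `V` from the first. -/

/-- **Multivariate central limit theorem**, for vectors with identity covariance. -/
theorem tendstoInDistribution_inv_sqrt_smul_sum_stdGaussian {Ω Ω' E : Type*}
    [NormedAddCommGroup E] [InnerProductSpace ℝ E] [FiniteDimensional ℝ E]
    [MeasurableSpace E] [BorelSpace E] [MeasurableSpace Ω] [MeasurableSpace Ω']
    {μ : Measure Ω} [IsProbabilityMeasure μ] {ν : Measure Ω'} [IsProbabilityMeasure ν]
    {X : ℕ → Ω → E} {Z : Ω' → E} (hZ : HasLaw Z (stdGaussian E) ν)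
    (hX : MemLp (X 0) 2 μ)
    (h_mean : ∀ t : E, ∫ ω, ⟪X 0 ω, t⟫ ∂μ = 0)
    (h_cov : ∀ t : E, ∫ ω, ⟪X 0 ω, t⟫ ^ 2 ∂μ = ‖t‖ ^ 2)
    (hindep : iIndepFun X μ) (hident : ∀ i, IdentDistrib (X i) (X 0) μ μ) :
    TendstoInDistribution (fun (n : ℕ) ω => (√n)⁻¹ • ∑ k ∈ Finset.range n, X k ω) atTop Z
      (fun _ => μ) ν where
  forall_aemeasurable n :=
    .const_smul (Finset.aemeasurable_fun_sum _ fun _ _ => (hident _).aemeasurable_fst) _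
  aemeasurable_limit := hZ.aemeasurable
  tendsto := by
    have mX n := (hident n).aemeasurable_fst
    refine ProbabilityMeasure.tendsto_iff_tendsto_charFun.2 fun t => ?_
    have hm : Measurable fun x : E => ⟪x, t⟫ := by fun_prop
    have hL : MemLp (fun ω => ⟪X 0 ω, t⟫) 2 μ := hX.inner_const t
    have hvar : Var[fun ω => ⟪X 0 ω, t⟫; μ] = ‖t‖ ^ 2 := by
      rw [variance_eq_sub hL, h_mean t]
      simpa using h_cov t
    have hlim := tendstoInDistribution_inv_sqrt_mul_sum_sub (P := μ)
      (X := fun k ω => ⟪X k ω, t⟫) (Y := id)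
      (P' := gaussianReal 0 Var[fun ω => ⟪X 0 ω, t⟫; μ].toNNReal) HasLaw.id hL
      (hindep.comp (fun _ x => ⟪x, t⟫) fun _ => hm) (fun i => (hident i).comp hm)
    -- Cramér–Wold: the characteristic function of a vector at `t` is that of its projection on `t`
    -- at `1`.
    have hchar := ProbabilityMeasure.tendsto_iff_tendsto_charFun.1 hlim.tendsto 1
    simp only [h_mean t, hvar, ProbabilityMeasure.coe_mk, Measure.map_id, charFun_gaussianReal]
      at hchar
    simp only [ProbabilityMeasure.coe_mk]
    rw [hZ.map_eq, charFun_stdGaussian]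
    have hS (n : ℕ) : AEMeasurable (fun ω => (√n)⁻¹ • ∑ k ∈ Finset.range n, X k ω) μ :=
      .const_smul (Finset.aemeasurable_fun_sum _ fun _ _ => mX _) _
    have hS' (n : ℕ) : AEMeasurable
        (fun ω => (√n)⁻¹ * (∑ k ∈ Finset.range n, ⟪X k ω, t⟫ - n * 0)) μ :=
      .const_mul (.sub (Finset.aemeasurable_fun_sum _ fun k _ => hm.comp_aemeasurable (mX k))
        (by fun_prop)) _
    convert hchar using 2 with n
    · rw [charFun_apply, charFun_apply, integral_map (hS n) (by fun_prop),
        integral_map (hS' n) (by fun_prop)]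
      simp [real_inner_smul_left, sum_inner]
    · rw [Real.coe_toNNReal _ (by positivity)]
      simp
      ring_nf

/-! ### Orthonormality of the harmonics -/

/-- The integral against the uniform distribution on the circle, as an interval integral. -/
theorem integral_circleUniform {f : AddCircle (2 * π) → ℝ} (hf : Measurable f) :
    ∫ x, f x ∂circleUniform = (2 * π)⁻¹ * ∫ t in (0 : ℝ)..2 * π, f (t : AddCircle (2 * π)) := by
  rw [circleUniform, integral_map (by fun_prop) hf.aestronglyMeasurable, ProbabilityTheory.cond,
    integral_smul_measure,
    intervalIntegral.integral_of_le (by positivity), integral_Ico_eq_integral_Ioc]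
  simp [Real.pi_pos.le]

/-- The real and imaginary parts of the first two powers of a point of the circle. -/
noncomputable def circleHarmonics (x : AddCircle (2 * π)) : EuclideanSpace ℝ (Fin 2 ⊕ Fin 2) :=
  WithLp.toLp 2 (Sum.elim
    ![√2 * Real.Angle.cos x, √2 * Real.Angle.sin x]
    ![√2 * (Real.Angle.cos x ^ 2 - Real.Angle.sin x ^ 2),
      √2 * (2 * Real.Angle.cos x * Real.Angle.sin x)])

theorem continuous_circle_cos : Continuous fun x : AddCircle (2 * π) => Real.Angle.cos x :=
  Real.Angle.continuous_cos

theorem continuous_circle_sin : Continuous fun x : AddCircle (2 * π) => Real.Angle.sin x :=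
  Real.Angle.continuous_sin

theorem circle_cos_sq_add_sin_sq (x : AddCircle (2 * π)) :
    Real.Angle.cos x ^ 2 + Real.Angle.sin x ^ 2 = 1 :=
  Real.Angle.cos_sq_add_sin_sq x

theorem circle_cos_sub (x y : AddCircle (2 * π)) :
    Real.Angle.cos (x - y) =
      Real.Angle.cos x * Real.Angle.cos y + Real.Angle.sin x * Real.Angle.sin y := by
  induction x using Real.Angle.induction_on with | _ a
  induction y using Real.Angle.induction_on with | _ b
  exact Real.cos_sub a b

theorem continuous_circleHarmonics : Continuous circleHarmonics := by
  have hc := continuous_circle_cos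
  have hs := continuous_circle_sin
  refine (PiLp.continuous_toLp 2 _).comp (continuous_pi ?_)
  rintro (i | i) <;> fin_cases i <;> simp <;> fun_prop

theorem inner_circleHarmonics (x : AddCircle (2 * π)) (t : EuclideanSpace ℝ (Fin 2 ⊕ Fin 2)) :
    ⟪circleHarmonics x, t⟫ = √2 * (t (.inl 0) * Real.Angle.cos x + t (.inl 1) * Real.Angle.sin x +
      t (.inr 0) * (Real.Angle.cos x ^ 2 - Real.Angle.sin x ^ 2) +
      t (.inr 1) * (2 * Real.Angle.cos x * Real.Angle.sin x)) := by
  simp [circleHarmonics, PiLp.inner_apply, Fintype.sum_sum_type, Fin.sum_univ_two]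
  ring

theorem integral_inner_circleHarmonics (t : EuclideanSpace ℝ (Fin 2 ⊕ Fin 2)) :
    ∫ x, ⟪circleHarmonics x, t⟫ ∂circleUniform = 0 := by
  have hm : Measurable fun x => ⟪circleHarmonics x, t⟫ :=
    (continuous_circleHarmonics.inner continuous_const).measurable
  rw [integral_circleUniform hm]
  simp only [inner_circleHarmonics]
  have h : ∀ u ∈ Set.uIcc 0 (2 * π), HasDerivAt (fun u : ℝ => √2 * (t (.inl 0) * Real.sin u -
      t (.inl 1) * Real.cos u + t (.inr 0) * (Real.sin u * Real.cos u) +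
      t (.inr 1) * Real.sin u ^ 2))
      (√2 * (t (.inl 0) * Real.cos u + t (.inl 1) * Real.sin u +
      t (.inr 0) * (Real.cos u ^ 2 - Real.sin u ^ 2) +
      t (.inr 1) * (2 * Real.cos u * Real.sin u))) u := by
    intro u _
    have hs := Real.hasDerivAt_sin u
    have hc := Real.hasDerivAt_cos u
    refine HasDerivAt.congr_deriv (((((hs.const_mul (t (.inl 0))).sub (hc.const_mul (t (.inl 1)))).add
      ((hs.mul hc).const_mul (t (.inr 0)))).add ((hs.pow 2).const_mul (t (.inr 1)))).const_mul √2) ?_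
    simp
    ring
  have := intervalIntegral.integral_eq_sub_of_hasDerivAt h
    (Continuous.intervalIntegrable (by fun_prop) _ _)
  refine mul_eq_zero_of_right _ (Eq.trans this ?_)
  simp

theorem integral_inner_circleHarmonics_sq (t : EuclideanSpace ℝ (Fin 2 ⊕ Fin 2)) :
    ∫ x, ⟪circleHarmonics x, t⟫ ^ 2 ∂circleUniform = ‖t‖ ^ 2 := by
  have hm : Measurable fun x => ⟪circleHarmonics x, t⟫ ^ 2 :=
    ((continuous_circleHarmonics.inner continuous_const).pow 2).measurable
  rw [integral_circleUniform hm, EuclideanSpace.real_norm_sq_eq]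
  simp only [inner_circleHarmonics, Fintype.sum_sum_type, Fin.sum_univ_two]
  generalize t (.inl 0) = a, t (.inl 1) = b, t (.inr 0) = p, t (.inr 1) = q
  -- An explicit antiderivative; only its first term is not `2π`-periodic, so that term alone
  -- contributes.
  have h : ∀ u ∈ Set.uIcc 0 (2 * π), HasDerivAt (fun u : ℝ =>
      (a ^ 2 + b ^ 2 + p ^ 2 + q ^ 2) * u + (a ^ 2 - b ^ 2) * (Real.sin u * Real.cos u)
      + (p ^ 2 - q ^ 2) * (Real.sin u * Real.cos u * (Real.cos u ^ 2 - Real.sin u ^ 2))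
      + 2 * a * b * Real.sin u ^ 2
      + 4 * a * p * (Real.sin u - 2 / 3 * Real.sin u ^ 3)
      - 8 / 3 * a * q * Real.cos u ^ 3
      + 4 * b * p * (Real.cos u - 2 / 3 * Real.cos u ^ 3)
      + 8 / 3 * b * q * Real.sin u ^ 3
      + 4 * p * q * (Real.sin u ^ 2 - Real.sin u ^ 4))
      ((√2 * (a * Real.cos u + b * Real.sin u + p * (Real.cos u ^ 2 - Real.sin u ^ 2) +
      q * (2 * Real.cos u * Real.sin u))) ^ 2) u := by
    intro u _
    have hs := Real.hasDerivAt_sin u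
    have hc := Real.hasDerivAt_cos u
    refine HasDerivAt.congr_deriv ((((((((((hasDerivAt_id u).const_mul (a ^ 2 + b ^ 2 + p ^ 2 + q ^ 2)).add
      ((hs.mul hc).const_mul (a ^ 2 - b ^ 2))).add
      (((hs.mul hc).mul ((hc.pow 2).sub (hs.pow 2))).const_mul (p ^ 2 - q ^ 2))).add
      ((hs.pow 2).const_mul (2 * a * b))).add
      ((hs.sub ((hs.pow 3).const_mul (2 / 3))).const_mul (4 * a * p))).sub
      ((hc.pow 3).const_mul (8 / 3 * a * q))).add
      ((hc.sub ((hc.pow 3).const_mul (2 / 3))).const_mul (4 * b * p))).add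
      ((hs.pow 3).const_mul (8 / 3 * b * q))).add
      (((hs.pow 2).sub (hs.pow 4)).const_mul (4 * p * q))) ?_
    have h1 : Real.cos u ^ 2 = 1 - Real.sin u ^ 2 := by linarith [Real.sin_sq_add_cos_sq u]
    have h3 : Real.cos u ^ 3 = Real.cos u * (1 - Real.sin u ^ 2) := by rw [← h1]; ring
    have h4 : Real.cos u ^ 4 = (1 - Real.sin u ^ 2) ^ 2 := by rw [← h1]; ring
    have h2 : √2 ^ 2 = 2 := Real.sq_sqrt (by norm_num)
    simp
    ring_nf
    simp only [h1, h2, h3, h4]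
    ring
  have := intervalIntegral.integral_eq_sub_of_hasDerivAt h
    (Continuous.intervalIntegrable (by fun_prop) _ _)
  refine (congrArg _ this).trans ?_
  simp
  field_simp
  ring

/-! ### The empirical object shape as a function of the mean harmonics -/

theorem isProbabilityMeasure_empiricalMeasure {S : Type*} [MeasurableSpace S] {n : ℕ} (hn : n ≠ 0)
    (x : Fin n → S) : IsProbabilityMeasure (empiricalMeasure x) where
  measure_univ := by
    simp [empiricalMeasure, ENNReal.inv_mul_cancel, hn]

theorem integral_empiricalMeasure {S : Type*} [MeasurableSpace S] [MeasurableSingletonClass S]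
    {n : ℕ} (x : Fin n → S) (f : S → ℝ) :
    ∫ y, f y ∂empiricalMeasure x = (n : ℝ)⁻¹ * ∑ i, f (x i) := by
  rw [empiricalMeasure, integral_smul_measure,
    integral_finsetSum_measure fun i _ => integrable_dirac (by simp)]
  simp

theorem circleDist_sq (x y : AddCircle (2 * π)) :
    circleDist x y ^ 2 =
      1 - (Real.Angle.cos x * Real.Angle.cos y + Real.Angle.sin x * Real.Angle.sin y) := by
  rw [circleDist, Real.sq_sqrt, circle_cos_sub]
  rw [circle_cos_sub]
  nlinarith [circle_cos_sq_add_sin_sq x, circle_cos_sq_add_sin_sq y,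
    sq_nonneg (Real.Angle.cos x - Real.Angle.cos y),
    sq_nonneg (Real.Angle.sin x - Real.Angle.sin y)]

theorem circleDist_pow_four (x y : AddCircle (2 * π)) :
    circleDist x y ^ 4 =
      (1 - (Real.Angle.cos x * Real.Angle.cos y + Real.Angle.sin x * Real.Angle.sin y)) ^ 2 := by
  rw [← circleDist_sq]
  ring

/-- The average of the harmonics over a finite sample. -/
noncomputable def meanHarmonics {n : ℕ} (x : Fin n → AddCircle (2 * π)) :
    EuclideanSpace ℝ (Fin 2 ⊕ Fin 2) :=
  (n : ℝ)⁻¹ • ∑ i, circleHarmonics (x i)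

/-- The numerator of the object shape, in terms of the mean harmonics. -/
noncomputable def shapeNum (m : EuclideanSpace ℝ (Fin 2 ⊕ Fin 2)) : ℝ :=
  1 - 3 / 4 * (m (.inl 0) ^ 2 + m (.inl 1) ^ 2) +
    (√2)⁻¹ / 4 * (m (.inr 0) * (m (.inl 0) ^ 2 - m (.inl 1) ^ 2) +
      2 * m (.inl 0) * m (.inl 1) * m (.inr 1))

/-- The denominator of the object shape, in terms of the mean harmonics. -/
noncomputable def shapeDen (m : EuclideanSpace ℝ (Fin 2 ⊕ Fin 2)) : ℝ :=
  3 / 2 - (m (.inl 0) ^ 2 + m (.inl 1) ^ 2) + (m (.inr 0) ^ 2 + m (.inr 1) ^ 2) / 4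

/-- Both inner sums equal `n - c i * C - s i * S`; in the square, `c²`, `s²` and `c * s` become `(1
+ p)/2`, `(1 - p)/2` and `q/2`, which is linear in the harmonics. -/
theorem sum_sum_mul_sum_harmonics {ι : Type*} [Fintype ι] {c s p q : ι → ℝ}
    (hcs : ∀ i, c i ^ 2 + s i ^ 2 = 1) (hp : ∀ i, p i = c i ^ 2 - s i ^ 2)
    (hq : ∀ i, q i = 2 * c i * s i) :
    ∑ i, (∑ j, (1 - (c i * c j + s i * s j))) * ∑ k, (1 - (c i * c k + s i * s k)) =
      Fintype.card ι ^ 3 - 3 / 2 * Fintype.card ι * ((∑ i, c i) ^ 2 + (∑ i, s i) ^ 2) +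
        1 / 2 * ((∑ i, p i) * ((∑ i, c i) ^ 2 - (∑ i, s i) ^ 2) +
          2 * (∑ i, c i) * (∑ i, s i) * ∑ i, q i) := by
  simp only [Finset.sum_sub_distrib, Finset.sum_add_distrib, ← Finset.mul_sum, Finset.sum_const,
    Finset.card_univ, nsmul_eq_mul, mul_one]
  generalize hC : ∑ i, c i = C, hS : ∑ i, s i = S
  calc _ = ∑ i, (Fintype.card ι ^ 2 + (C ^ 2 + S ^ 2) / 2 - 2 * Fintype.card ι * C * c i
          - 2 * Fintype.card ι * S * s i + (C ^ 2 - S ^ 2) / 2 * p i + C * S * q i) := by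
        refine Finset.sum_congr rfl fun i _ => ?_
        rw [hp, hq]
        linear_combination (C ^ 2 + S ^ 2) / 2 * hcs i
    _ = _ := by
        simp only [Finset.sum_sub_distrib, Finset.sum_add_distrib, ← Finset.mul_sum,
          Finset.sum_const, Finset.card_univ, nsmul_eq_mul, hC, hS]
        ring

/-- This is `(1 - cos δ)² = 3/2 - 2 cos δ + (cos 2δ)/2`, with `cos δ` and `cos 2δ` expanded by the
addition formula. -/
theorem sum_sum_sq_harmonics {ι : Type*} [Fintype ι] {c s p q : ι → ℝ}
    (hcs : ∀ i, c i ^ 2 + s i ^ 2 = 1) (hp : ∀ i, p i = c i ^ 2 - s i ^ 2)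
    (hq : ∀ i, q i = 2 * c i * s i) :
    ∑ i, ∑ j, (1 - (c i * c j + s i * s j)) ^ 2 =
      3 / 2 * Fintype.card ι ^ 2 - 2 * ((∑ i, c i) ^ 2 + (∑ i, s i) ^ 2) +
        1 / 2 * ((∑ i, p i) ^ 2 + (∑ i, q i) ^ 2) := by
  calc _ = ∑ i, ∑ j, (3 / 2 - 2 * c i * c j - 2 * s i * s j + p i / 2 * p j + q i / 2 * q j) := by
        refine Finset.sum_congr rfl fun i _ => Finset.sum_congr rfl fun j _ => ?_
        rw [hp, hp, hq, hq]
        linear_combination (c j ^ 2 + s j ^ 2) / 2 * hcs i + 1 / 2 * hcs j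
    _ = _ := by
        simp only [Finset.sum_sub_distrib, Finset.sum_add_distrib, ← Finset.mul_sum,
          Finset.sum_const, Finset.card_univ, nsmul_eq_mul, ← Finset.sum_mul, ← Finset.sum_div]
        ring

theorem objectShape_empiricalMeasure {n : ℕ} (hn : n ≠ 0) (x : Fin n → AddCircle (2 * π)) :
    objectShape circleDist (empiricalMeasure x) =
      shapeNum (meanHarmonics x) / shapeDen (meanHarmonics x) := by
  have : Fact (0 < 2 * π) := ⟨Real.two_pi_pos⟩
  have := isProbabilityMeasure_empiricalMeasure hn x
  have hc := continuous_circle_cos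
  have hs := continuous_circle_sin
  have hn' : (n : ℝ) ≠ 0 := by exact_mod_cast hn
  have h2 : √2 ^ 2 = 2 := Real.sq_sqrt (by norm_num)
  set c : Fin n → ℝ := fun i => Real.Angle.cos (x i)
  set s : Fin n → ℝ := fun i => Real.Angle.sin (x i)
  set p : Fin n → ℝ := fun i => c i ^ 2 - s i ^ 2
  set q : Fin n → ℝ := fun i => 2 * c i * s i
  have hcs (i : Fin n) : c i ^ 2 + s i ^ 2 = 1 := circle_cos_sq_add_sin_sq (x i)
  have m0 : meanHarmonics x (.inl 0) = (n : ℝ)⁻¹ * (√2 * ∑ i, c i) := by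
    simp [meanHarmonics, circleHarmonics, Finset.mul_sum, c]
  have m1 : meanHarmonics x (.inl 1) = (n : ℝ)⁻¹ * (√2 * ∑ i, s i) := by
    simp [meanHarmonics, circleHarmonics, Finset.mul_sum, s]
  have m2 : meanHarmonics x (.inr 0) = (n : ℝ)⁻¹ * (√2 * ∑ i, p i) := by
    simp [meanHarmonics, circleHarmonics, Finset.mul_sum, s, c, p, -Finset.sum_sub_distrib]
  have m3 : meanHarmonics x (.inr 1) = (n : ℝ)⁻¹ * (√2 * ∑ i, q i) := by
    simp [meanHarmonics, circleHarmonics, Finset.mul_sum, s, c, q]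
  rw [objectShape]
  congr 1
  · simp only [circleDist_sq]
    rw [integral_prod _ (Continuous.integrable_of_hasCompactSupport (by fun_prop)
      (HasCompactSupport.of_compactSpace _))]
    -- Given the first point, the other two are independent, so the inner integral is a square.
    have inner (y : AddCircle (2 * π)) :
        ∫ z : AddCircle (2 * π) × AddCircle (2 * π),
          (1 - (Real.Angle.cos y * Real.Angle.cos z.1 + Real.Angle.sin y * Real.Angle.sin z.1)) *
          (1 - (Real.Angle.cos y * Real.Angle.cos z.2 + Real.Angle.sin y * Real.Angle.sin z.2))
          ∂((empiricalMeasure x).prod (empiricalMeasure x)) =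
        ((n : ℝ)⁻¹ * ∑ j, (1 - (Real.Angle.cos y * c j + Real.Angle.sin y * s j))) ^ 2 := by
      rw [sq]
      refine (integral_prod_mul
        (fun z : AddCircle (2 * π) => 1 - (Real.Angle.cos y * Real.Angle.cos z +
          Real.Angle.sin y * Real.Angle.sin z))
        (fun z : AddCircle (2 * π) => 1 - (Real.Angle.cos y * Real.Angle.cos z +
          Real.Angle.sin y * Real.Angle.sin z))).trans ?_
      simp only [integral_empiricalMeasure]
      rfl
    rw [integral_congr_ae (ae_of_all _ inner), integral_empiricalMeasure]
    have key := sum_sum_mul_sum_harmonics hcs (fun _ => rfl : ∀ i, p i = _)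
      (fun _ => rfl : ∀ i, q i = _)
    calc _ = (n : ℝ)⁻¹ ^ 3 * ∑ i, (∑ j, (1 - (c i * c j + s i * s j))) *
          ∑ k, (1 - (c i * c k + s i * s k)) := by
          simp only [Finset.mul_sum _ _ ((n : ℝ)⁻¹ ^ 3)]
          rw [Finset.mul_sum]
          refine Finset.sum_congr rfl fun i _ => ?_
          change (n : ℝ)⁻¹ * ((n : ℝ)⁻¹ * ∑ j, (1 - (c i * c j + s i * s j))) ^ 2 = _
          ring
      _ = _ := by
          have h3 : (√2)⁻¹ = √2 / 2 := by field_simp; linarith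
          have h4 : √2 * √2 * √2 * √2 = 4 := by
            calc _ = (√2 ^ 2) ^ 2 := by ring
              _ = 4 := by rw [h2]; norm_num
          rw [key, shapeNum, m0, m1, m2, m3, h3, Fintype.card_fin]
          generalize ∑ i, c i = C, ∑ i, s i = S, ∑ i, p i = P, ∑ i, q i = Q
          field_simp
          ring_nf
          have h5 : √2 ^ 4 = 4 := by rw [← h4]; ring
          simp only [h2, h5]
          ring
  · simp only [circleDist_pow_four]
    rw [integral_prod _ (Continuous.integrable_of_hasCompactSupport (by fun_prop)
      (HasCompactSupport.of_compactSpace _))]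
    simp only [integral_empiricalMeasure]
    have key := sum_sum_sq_harmonics hcs (fun _ => rfl : ∀ i, p i = _)
      (fun _ => rfl : ∀ i, q i = _)
    calc _ = (n : ℝ)⁻¹ ^ 2 * ∑ i, ∑ j, (1 - (c i * c j + s i * s j)) ^ 2 := by
          rw [← Finset.mul_sum, ← mul_assoc, ← sq]
      _ = _ := by
          rw [key, shapeDen, m0, m1, m2, m3, Fintype.card_fin]
          simp only [mul_pow, h2]
          field_simp
          ring

/-! ### The limit law and the deviation functional -/

theorem hasLaw_blocks_sq_stdGaussian :
    HasLaw (fun z : EuclideanSpace ℝ (Fin 2 ⊕ Fin 2) =>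
      (∑ i, z (.inr i) ^ 2, ∑ i, z (.inl i) ^ 2)) ((chiSquare 2).prod (chiSquare 2))
      (stdGaussian (EuclideanSpace ℝ (Fin 2 ⊕ Fin 2))) := by
  refine ⟨by fun_prop, ?_⟩
  rw [← map_pi_eq_stdGaussian, Measure.map_map (by fun_prop) (by fun_prop), chiSquare,
    -- The swap puts the second-harmonic block first, to match the order `(U, V)`.
    Measure.map_prod_map _ _ (by fun_prop) (by fun_prop), ← Measure.prod_swap,
    ← (measurePreserving_sumPiEquivProdPi (ι := Fin 2) (ι' := Fin 2)
      (X := fun _ => ℝ) fun _ => gaussianReal 0 1).map_eq,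
    Measure.map_map (by fun_prop) (MeasurableEquiv.measurable _),
    Measure.map_map (by fun_prop) (by fun_prop)]
  rfl

/-- The rescaled deviation of the object shape, as a function of the rescaled mean harmonics `y.1`
and the mean harmonics `y.2`; the denominator is truncated to be bounded below. -/
noncomputable def shapeDeviation
    (y : EuclideanSpace ℝ (Fin 2 ⊕ Fin 2) × EuclideanSpace ℝ (Fin 2 ⊕ Fin 2)) : ℝ :=
  ((y.1 (.inl 0) ^ 2 + y.1 (.inl 1) ^ 2) / 4 + (y.1 (.inr 0) ^ 2 + y.1 (.inr 1) ^ 2) / 2 -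
    3 * (√2)⁻¹ / 4 * (y.2 (.inr 0) * (y.1 (.inl 0) ^ 2 - y.1 (.inl 1) ^ 2) +
      2 * y.1 (.inl 0) * y.1 (.inl 1) * y.2 (.inr 1))) / (3 * max (shapeDen y.2) 1)

theorem continuous_shapeDen : Continuous shapeDen := by
  unfold shapeDen
  fun_prop

theorem continuous_shapeDeviation : Continuous shapeDeviation := by
  have := continuous_shapeDen
  unfold shapeDeviation
  refine Continuous.div (by fun_prop) (by fun_prop) fun y => ?_
  have := le_max_right (shapeDen y.2) 1
  positivity

theorem shapeDeviation_zero_right (w : EuclideanSpace ℝ (Fin 2 ⊕ Fin 2)) :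
    shapeDeviation (w, 0) = 2 / 18 * ∑ i, w (.inr i) ^ 2 + 1 / 18 * ∑ i, w (.inl i) ^ 2 := by
  have : max (3 / 2 : ℝ) 1 = 3 / 2 := max_eq_left (by norm_num)
  simp [shapeDeviation, shapeDen, Fin.sum_univ_two, this]
  ring

/-- Every term of `2 * shapeDen m - 3 * shapeNum m` has a quadratic factor that absorbs `n = (√n)²`;
the third factor of the cubic terms stays unscaled. -/
theorem shapeDeviation_eq_of_one_le_shapeDen {m : EuclideanSpace ℝ (Fin 2 ⊕ Fin 2)}
    (hm : 1 ≤ shapeDen m) (n : ℕ) :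
    n * (2 / 3 - shapeNum m / shapeDen m) = shapeDeviation (√n • m, m) := by
  have hn : √(n : ℝ) ^ 2 = n := Real.sq_sqrt n.cast_nonneg
  have h0 : shapeDen m ≠ 0 := by positivity
  have h1 : n * (2 / 3 - shapeNum m / shapeDen m) =
      n * (2 * shapeDen m - 3 * shapeNum m) / (3 * shapeDen m) := by
    field_simp
  rw [h1, shapeDeviation, max_eq_left hm]
  congr 1
  simp only [PiLp.smul_apply, smul_eq_mul, shapeDen, shapeNum]
  nth_rewrite 1 [← hn]
  ring

/-! ### Limit theorems for the sample -/

theorem measurable_circleHarmonics : Measurable circleHarmonics :=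
  continuous_circleHarmonics.measurable

theorem norm_circleHarmonics_sq (x : AddCircle (2 * π)) : ‖circleHarmonics x‖ ^ 2 = 4 := by
  have h := circle_cos_sq_add_sin_sq x
  have h2 : √2 ^ 2 = 2 := Real.sq_sqrt (by norm_num)
  rw [EuclideanSpace.real_norm_sq_eq]
  simp [circleHarmonics, Fintype.sum_sum_type, Fin.sum_univ_two, mul_pow, h2]
  linear_combination (2 + 2 * (Real.Angle.cos x ^ 2 + Real.Angle.sin x ^ 2 + 1)) * h

section Sample

variable {Ω : Type*} [MeasurableSpace Ω] {μ : Measure Ω}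
  {X : ℕ → Ω → AddCircle (2 * π)}

theorem memLp_circleHarmonics [IsFiniteMeasure μ] {Y : Ω → AddCircle (2 * π)} (hY : AEMeasurable Y μ) (p : ℝ≥0∞) :
    MemLp (fun ω => circleHarmonics (Y ω)) p μ := by
  refine MemLp.of_bound (measurable_circleHarmonics.comp_aemeasurable hY).aestronglyMeasurable 2
    (ae_of_all _ fun ω => ?_)
  have := norm_circleHarmonics_sq (Y ω)
  nlinarith [norm_nonneg (circleHarmonics (Y ω))]

theorem meanHarmonics_eq_sum_range (x : ℕ → AddCircle (2 * π)) (n : ℕ) :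
    meanHarmonics (fun i : Fin n => x i) =
      (n : ℝ)⁻¹ • ∑ k ∈ Finset.range n, circleHarmonics (x k) := by
  rw [meanHarmonics, Fin.sum_univ_eq_sum_range fun k => circleHarmonics (x k)]

theorem sqrt_smul_meanHarmonics (x : ℕ → AddCircle (2 * π)) (n : ℕ) :
    √n • meanHarmonics (fun i : Fin n => x i) =
      (√n)⁻¹ • ∑ k ∈ Finset.range n, circleHarmonics (x k) := by
  rw [meanHarmonics_eq_sum_range, smul_smul]
  congr 1
  rcases Nat.eq_zero_or_pos n with rfl | hn
  · simp
  · have : √(n : ℝ) ^ 2 = n := Real.sq_sqrt n.cast_nonneg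
    have : (n : ℝ) ≠ 0 := by positivity
    field_simp
    assumption

theorem identDistrib_circleHarmonics (hX_law : ∀ i, HasLaw (X i) circleUniform μ) (i : ℕ) :
    IdentDistrib (fun ω => circleHarmonics (X i ω)) (fun ω => circleHarmonics (X 0 ω)) μ μ :=
  ((hX_law i).identDistrib (hX_law 0)).comp measurable_circleHarmonics

theorem integral_inner_circleHarmonics_comp {Y : Ω → AddCircle (2 * π)}
    (hY : HasLaw Y circleUniform μ) (t : EuclideanSpace ℝ (Fin 2 ⊕ Fin 2)) :
    ∫ ω, ⟪circleHarmonics (Y ω), t⟫ ∂μ = 0 :=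
  (hY.integral_comp (f := fun x => ⟪circleHarmonics x, t⟫)
    (continuous_circleHarmonics.inner continuous_const).measurable.aestronglyMeasurable).trans
    (integral_inner_circleHarmonics t)

theorem integral_inner_circleHarmonics_sq_comp {Y : Ω → AddCircle (2 * π)}
    (hY : HasLaw Y circleUniform μ) (t : EuclideanSpace ℝ (Fin 2 ⊕ Fin 2)) :
    ∫ ω, ⟪circleHarmonics (Y ω), t⟫ ^ 2 ∂μ = ‖t‖ ^ 2 :=
  (hY.integral_comp (f := fun x => ⟪circleHarmonics x, t⟫ ^ 2)
    ((continuous_circleHarmonics.inner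
      continuous_const).pow 2).measurable.aestronglyMeasurable).trans
    (integral_inner_circleHarmonics_sq t)

theorem tendsto_meanHarmonics_ae [IsProbabilityMeasure μ]
    (hX_law : ∀ i, HasLaw (X i) circleUniform μ)
    (hX_indep : iIndepFun X μ) :
    ∀ᵐ ω ∂μ, Tendsto (fun n : ℕ => meanHarmonics fun i : Fin n => X i ω) atTop (𝓝 0) := by
  have hint : Integrable (fun ω => circleHarmonics (X 0 ω)) μ :=
    memLp_one_iff_integrable.1 (memLp_circleHarmonics (hX_law 0).aemeasurable 1)
  have hmean : ∫ ω, circleHarmonics (X 0 ω) ∂μ = 0 := by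
    refine ext_inner_right ℝ fun t => ?_
    rw [inner_zero_left, real_inner_comm, ← integral_inner hint,
      ← integral_inner_circleHarmonics_comp (hX_law 0) t]
    simp only [real_inner_comm]
  have := strong_law_ae (fun k ω => circleHarmonics (X k ω)) hint
    (fun i j hij => (hX_indep.indepFun hij).comp measurable_circleHarmonics
      measurable_circleHarmonics)
    (identDistrib_circleHarmonics hX_law)
  rw [hmean] at this
  filter_upwards [this] with ω hω
  simpa only [meanHarmonics_eq_sum_range fun k => X k ω] using hω

theorem aemeasurable_meanHarmonics (hX : ∀ i, AEMeasurable (X i) μ) (n : ℕ) :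
    AEMeasurable (fun ω => meanHarmonics fun i : Fin n => X i ω) μ := by
  have h (i : Fin n) : AEMeasurable (fun ω => circleHarmonics (X i ω)) μ :=
    measurable_circleHarmonics.comp_aemeasurable (hX i)
  unfold meanHarmonics
  fun_prop

theorem aemeasurable_deviation_objectShape (hX : ∀ i, AEMeasurable (X i) μ) (n : ℕ) :
    AEMeasurable (fun ω => (n : ℝ) *
      (2 / 3 - objectShape circleDist (empiricalMeasure fun i : Fin n => X i ω))) μ := by
  rcases eq_or_ne n 0 with rfl | hn
  · simp
  · have hm := aemeasurable_meanHarmonics hX n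
    have hD : Measurable shapeDen := continuous_shapeDen.measurable
    have hN : Measurable shapeNum := by unfold shapeNum; fun_prop
    simp only [objectShape_empiricalMeasure hn]
    fun_prop

end Sample

/-! ### Assembly by Slutsky's theorem -/

theorem theorem5
    {Ω : Type*} [MeasurableSpace Ω] (μ : Measure Ω) [IsProbabilityMeasure μ]
    {Ω' : Type*} [MeasurableSpace Ω'] (ν : Measure Ω') [IsProbabilityMeasure ν]
    (X : ℕ → Ω → AddCircle (2 * π))
    (hX_law : ∀ i, HasLaw (X i) circleUniform μ) (hX_indep : iIndepFun X μ)
    (U V : Ω' → ℝ)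
    (hU : HasLaw U (chiSquare 2) ν) (hV : HasLaw V (chiSquare 2) ν) (hUV : IndepFun U V ν) :
    TendstoInDistribution
      (fun (n : ℕ) (ω : Ω) =>
        (n : ℝ) * (2 / 3 - objectShape circleDist (empiricalMeasure fun i : Fin n => X i ω)))
      atTop
      (fun ω' : Ω' => 2 / 18 * U ω' + 1 / 18 * V ω')
      (fun _ => μ) ν := by
  have hX i := (hX_law i).aemeasurable
  have hM := aemeasurable_meanHarmonics hX
  have hM_lim := tendsto_meanHarmonics_ae hX_law hX_indep
  have hCLT : TendstoInDistribution
      (fun (n : ℕ) (ω : Ω) => √n • meanHarmonics fun i : Fin n => X i ω) atTop id (fun _ => μ)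
      (stdGaussian (EuclideanSpace ℝ (Fin 2 ⊕ Fin 2))) := by
    have hsum (n : ℕ) (ω : Ω) := sqrt_smul_meanHarmonics (fun k => X k ω) n
    simp only [hsum]
    exact tendstoInDistribution_inv_sqrt_smul_sum_stdGaussian HasLaw.id
      (memLp_circleHarmonics (hX 0) 2) (integral_inner_circleHarmonics_comp (hX_law 0))
      (integral_inner_circleHarmonics_sq_comp (hX_law 0))
      (hX_indep.comp _ fun _ => measurable_circleHarmonics) (identDistrib_circleHarmonics hX_law)
  have hSlutsky := hCLT.continuous_comp_prodMk_of_tendstoInMeasure_const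
    continuous_shapeDeviation
    (tendstoInMeasure_of_tendsto_ae (fun n => (hM n).aestronglyMeasurable) hM_lim) hM
  have hdiff := tendstoInDistribution_of_tendstoInMeasure_sub (fun (n : ℕ) (ω : Ω) =>
      (n : ℝ) * (2 / 3 - objectShape circleDist (empiricalMeasure fun i : Fin n => X i ω)))
    _ hSlutsky
    (tendstoInMeasure_of_tendsto_ae
      (fun n => ((aemeasurable_deviation_objectShape hX n).sub
        (hSlutsky.forall_aemeasurable n)).aestronglyMeasurable) ?_)
    (aemeasurable_deviation_objectShape hX)
  -- The limit found so far lives on the Gaussian space; only its law matters, so it may be replaced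
  -- by the combination of `U` and `V`.
  · have hlaw : (stdGaussian (EuclideanSpace ℝ (Fin 2 ⊕ Fin 2))).map
        (fun w => shapeDeviation (id w, 0)) =
        ν.map fun ω' => 2 / 18 * U ω' + 1 / 18 * V ω' := by
      have : IsProbabilityMeasure (chiSquare 2) := by
        rw [← hU.map_eq]; exact Measure.isProbabilityMeasure_map hU.aemeasurable
      have hUV_law := (indepFun_iff_hasLaw_prodMk_prod hU hV).1 hUV
      have hcomb : HasLaw (fun p : ℝ × ℝ => 2 / 18 * p.1 + 1 / 18 * p.2)
          (((chiSquare 2).prod (chiSquare 2)).map fun p => 2 / 18 * p.1 + 1 / 18 * p.2)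
          ((chiSquare 2).prod (chiSquare 2)) := ⟨by fun_prop, rfl⟩
      simp only [id, shapeDeviation_zero_right]
      exact (hcomb.comp hasLaw_blocks_sq_stdGaussian).map_eq.trans (hcomb.comp hUV_law).map_eq.symm
    have hmeas : AEMeasurable (fun ω' => 2 / 18 * U ω' + 1 / 18 * V ω') ν := by
      have := hU.aemeasurable
      have := hV.aemeasurable
      fun_prop
    refine ⟨hdiff.forall_aemeasurable, hmeas, ?_⟩
    convert hdiff.tendsto using 2
    exact congrArg 𝓝 (Subtype.ext hlaw.symm)
  · filter_upwards [hM_lim] with ω hω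
    -- As `shapeDen 0 = 3/2 > 1`, the truncation is eventually inactive and the difference is
    -- exactly zero.
    have hD : ∀ᶠ n : ℕ in atTop, 1 < shapeDen (meanHarmonics fun i : Fin n => X i ω) := by
      refine ((continuous_shapeDen.tendsto 0).comp hω).eventually_const_lt ?_
      norm_num [shapeDen]
    refine tendsto_const_nhds.congr' ?_
    filter_upwards [hD, eventually_ne_atTop 0] with n hn hn0
    simp only [Pi.sub_apply, Pi.zero_apply, objectShape_empiricalMeasure hn0,
      shapeDeviation_eq_of_one_le_shapeDen hn.le, sub_self]
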